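/- Let $n,K\ge 1$ be integers, let $\mathcal C$ be a nonempty finite class of $N$ distinct subsets of $\{1,\dots,n\}$, each of cardinality $K$, and let $\mu>0$. Let $\mathbb P_0$ (with expectation $\mathbb E_0$) be the law under which the components of $X=(X_1,\dots,X_n)$ are independent standard normal random variables, with density $\phi_0(x)=(2\pi)^{-n/2}e^{-\sum_{i=1}^n x_i^2/2}$, and for $S\in\mathcal C$ let $\phi_S(x)=(2\pi)^{-n/2}e^{-\sum_{i\in S}(x_i-\mu)^2/2-\sum_{i\notin S}x_i^2/2}$. Put $X_S=\sum_{i\in S}X_i$, and let $f^*$ be the optimal (likelihood ratio) test, $f^*(x)=1$ if $L(x)>1$ and $f^*(x)=0$ otherwise, where $$L(x)=\frac{\frac1N\sum_{S\in\mathcal C}\phi_S(x)}{\phi_0(x)}.$$ Equip $\mathcal C$ with the distance $d(S,T)=\sqrt{\mathbb E_0(X_S-X_T)^2}$, and let $\mathcal A\subset\mathcal C$ be any $\sqrt K/2$-cover of $\mathcal C$, that is, for every $S\in\mathcal C$ there is $T\in\mathcal A$ with $d(S,T)\le\sqrt K/2$. Then, for every $\delta\in(0,1)$, the type I error of $f^*$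 satisfies $$\mathbb P_0\{f^*(X)=1\}\le\delta$$ whenever $$\mu\ge\frac2K\,\mathbb E_0\max_{S\in\mathcal A}X_S+\sqrt{\frac{32\log(2/\delta)}{K}}.$$ -/

import Mathlib

open MeasureTheory ProbabilityTheory

namespace GaussianTesting

noncomputable section

/-- The law of the observation under the null hypothesis: `n` independent standard normal
components. -/
def nullMeasure (n : ℕ) : Measure (Fin n → ℝ) :=
  Measure.pi fun _ => gaussianReal 0 1

/-- `x_S`, the sum of the coordinates of `x` with index in `S`. -/
def setSum {n : ℕ} (S : Finset (Fin n)) (x : Fin n → ℝ) : ℝ :=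
  ∑ i ∈ S, x i

/-- The density of the observation under the null hypothesis. -/
def nullDensity (n : ℕ) (x : Fin n → ℝ) : ℝ :=
  (2 * Real.pi) ^ (-(n : ℝ) / 2) * Real.exp (-∑ i, x i ^ 2 / 2)

/-- The density of the observation under the alternative in which exactly the components with
index in `S` have mean `μ`. -/
def altDensity {n : ℕ} (μ : ℝ) (S : Finset (Fin n)) (x : Fin n → ℝ) : ℝ :=
  (2 * Real.pi) ^ (-(n : ℝ) / 2) *
    Real.exp (-∑ i ∈ S, (x i - μ) ^ 2 / 2 - ∑ i ∈ Sᶜ, x i ^ 2 / 2)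

/-- The likelihood ratio of the uniform mixture of the alternatives over the class `C` against
the null hypothesis. -/
def likelihoodRatio {n : ℕ} (C : Finset (Finset (Fin n))) (μ : ℝ) (x : Fin n → ℝ) : ℝ :=
  (1 / (C.card : ℝ) * ∑ S ∈ C, altDensity μ S x) / nullDensity n x

/-- The optimal test: reject (value `1`) if and only if the likelihood ratio exceeds `1`. -/
def optimalTest {n : ℕ} (C : Finset (Finset (Fin n))) (μ : ℝ) (x : Fin n → ℝ) : Fin 2 :=
  if 1 < likelihoodRatio C μ x then 1 else 0

/-- The canonical distance `d(S, T) = √(𝔼₀ (X_S - X_T)²)` (the square root of the Hamming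
distance). -/
def canonicalDist {n : ℕ} (S T : Finset (Fin n)) : ℝ :=
  Real.sqrt (∫ x, (setSum S x - setSum T x) ^ 2 ∂(nullMeasure n))

/-- `A` is a `t`-cover of `C`: a subclass such that each member of `C` is within canonical
distance `t` of some member of `A`. -/
def IsCover {n : ℕ} (t : ℝ) (C A : Finset (Finset (Fin n))) : Prop :=
  A ⊆ C ∧ ∀ S ∈ C, ∃ T ∈ A, canonicalDist S T ≤ t

theorem IsCover.nonempty {n : ℕ} {t : ℝ} {C A : Finset (Finset (Fin n))}
    (h : IsCover t C A) (hC : C.Nonempty) : A.Nonempty := by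
  obtain ⟨S, hS⟩ := hC
  obtain ⟨T, hT, -⟩ := h.2 S hS
  exact ⟨T, hT⟩

/-- The expected maximum `𝔼₀ max_{S ∈ A} X_S`. -/
def expectedMax {n : ℕ} (A : Finset (Finset (Fin n))) (hA : A.Nonempty) : ℝ :=
  ∫ x, A.sup' hA (fun S => setSum S x) ∂(nullMeasure n)

end

end GaussianTesting

namespace GaussianTesting

noncomputable section

/-! Let `M` be the maximum of `X_T` over the cover and `E` its null mean. If the test rejects,
either `M ≥ E + r`, or `M < E + r` and `L > 1`.

The first event is rare because `M` is sub-Gaussian at scale `√K`. On the second, choose for each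
`S` a close `T` in the cover and multiply its term of `L` by `exp (l (E + r - X_T)) ≥ 1`. Under the
law tilted by `S`, `X_T` has mean `μ |S ∩ T| ≥ 7Kμ/8`, well above `E + r`, so the enlarged `L` has
tiny null expectation. Markov's inequality (`typeIError_le`) then gives two exponentials, each made
at most `δ/2`.

Concentration of `M` (`integral_exp_sup'_sub_expectedMax_le`) is the Maurey–Pisier argument: join
two independent copies by a rotation through `π/2`, apply Jensen's inequality to the derivative
along the path, and use rotation invariance. The maximum is first smoothed to `softMax`, whose
gradient is a Gibbs average. The constant `π²/8` replaces the sharp `1/2`; the slack in the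
hypothesis on `μ` absorbs it. -/

/-! ### Gaussian integrals of the sums `X_S` -/

instance isProbabilityMeasure_nullMeasure (n : ℕ) : IsProbabilityMeasure (nullMeasure n) := by
  unfold nullMeasure; infer_instance

instance isGaussian_nullMeasure (n : ℕ) : IsGaussian (nullMeasure n) := by
  have h : nullMeasure n = (stdGaussian (EuclideanSpace ℝ (Fin n))).map
      (PiLp.continuousLinearEquiv 2 ℝ fun _ : Fin n => ℝ) := by
    rw [← map_pi_eq_stdGaussian, Measure.map_map (by fun_prop) (by fun_prop)]
    exact Measure.map_id.symm
  rw [h]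
  infer_instance

theorem integral_strongDual_nullMeasure (n : ℕ) (L : StrongDual ℝ (Fin n → ℝ)) :
    ∫ x, L x ∂(nullMeasure n) = 0 := by
  have h : ∫ x, x ∂(nullMeasure n) = 0 := by
    ext i
    have h := (ContinuousLinearMap.proj i : (Fin n → ℝ) →L[ℝ] ℝ).integral_comp_id_comm
      (μ := nullMeasure n) IsGaussian.integrable_id
    simp only [ContinuousLinearMap.proj_apply] at h
    rw [← h, nullMeasure, integral_eval]
    simp
  rw [L.integral_comp_id_comm IsGaussian.integrable_id, h, map_zero]

/-- A rotated pair of independent copies is again such a pair, since the law is Gaussian and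
centred. -/
theorem map_rotation_nullMeasure (n : ℕ) (θ : ℝ) :
    ((nullMeasure n).prod (nullMeasure n)).map (ContinuousLinearMap.rotation θ) =
      (nullMeasure n).prod (nullMeasure n) :=
  IsGaussian.map_rotation_eq_self_of_forall_strongDual_eq_zero
    (integral_strongDual_nullMeasure n) θ

theorem integrable_exp_linear {n : ℕ} (c : Fin n → ℝ) :
    Integrable (fun x => Real.exp (∑ i, c i * x i)) (nullMeasure n) := by
  simp_rw [Real.exp_sum]
  exact Integrable.fintype_prod (f := fun i t => Real.exp (c i * t))
    fun i => integrable_exp_mul_gaussianReal (c i)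

theorem integral_exp_linear {n : ℕ} (c : Fin n → ℝ) :
    ∫ x, Real.exp (∑ i, c i * x i) ∂(nullMeasure n) = Real.exp (∑ i, c i ^ 2 / 2) := by
  simp_rw [Real.exp_sum, nullMeasure]
  rw [integral_fintype_prod_eq_prod fun i t => Real.exp (c i * t)]
  refine Finset.prod_congr rfl fun i _ => ?_
  have := congrFun (mgf_id_gaussianReal (μ := 0) (v := 1)) (c i)
  simpa [mgf] using this

theorem integral_linear_sq {n : ℕ} (c : Fin n → ℝ) :
    ∫ x, (∑ i, c i * x i) ^ 2 ∂(nullMeasure n) = ∑ i, c i ^ 2 := by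
  have h := variance_sum_pi (μ := fun _ : Fin n => gaussianReal 0 1) (X := fun i t => c i * t)
    fun i => (IsGaussian.memLp_two_id (μ := gaussianReal 0 1)).const_mul (c i)
  have h0 : ∫ x, (∑ i, fun ω : Fin n → ℝ => c i * ω i) x ∂(nullMeasure n) = 0 := by
    simpa using integral_strongDual_nullMeasure n
      (∑ i, c i • (ContinuousLinearMap.proj i : (Fin n → ℝ) →L[ℝ] ℝ))
  rw [← nullMeasure, variance_of_integral_eq_zero (Measurable.aemeasurable (by fun_prop)) h0] at h
  have hv (i : Fin n) : Var[fun t => c i * t; gaussianReal 0 1] = c i ^ 2 := by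
    simpa using variance_const_mul (c i) id (gaussianReal 0 1)
  simpa [hv] using h

@[fun_prop]
theorem continuous_setSum {n : ℕ} (S : Finset (Fin n)) : Continuous (setSum S) := by
  unfold setSum; fun_prop

theorem setSum_smul_add {n : ℕ} (S : Finset (Fin n)) (a b : ℝ) (x y : Fin n → ℝ) :
    setSum S (a • x + b • y) = a * setSum S x + b * setSum S y := by
  simp [setSum, Finset.sum_add_distrib, Finset.mul_sum]

theorem integrable_setSum {n : ℕ} (S : Finset (Fin n)) :
    Integrable (setSum S) (nullMeasure n) := by
  have := IsGaussian.integrable_dual (nullMeasure n)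
    (∑ i ∈ S, (ContinuousLinearMap.proj i : (Fin n → ℝ) →L[ℝ] ℝ))
  refine this.congr (.of_forall fun x => ?_)
  simp [setSum]

theorem integral_setSum {n : ℕ} (S : Finset (Fin n)) :
    ∫ x, setSum S x ∂(nullMeasure n) = 0 := by
  have := integral_strongDual_nullMeasure n
    (∑ i ∈ S, (ContinuousLinearMap.proj i : (Fin n → ℝ) →L[ℝ] ℝ))
  simpa [setSum] using this

theorem combination_setSum_eq_linear {n : ℕ} (S T : Finset (Fin n)) (a b : ℝ) (x : Fin n → ℝ) :
    a * setSum S x + b * setSum T x =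
      ∑ i, (a * (if i ∈ S then 1 else 0) + b * (if i ∈ T then 1 else 0)) * x i := by
  simp [setSum, add_mul, Finset.sum_add_distrib, Finset.mul_sum]

theorem sum_combination_sq {n : ℕ} (S T : Finset (Fin n)) (a b : ℝ) :
    ∑ i, (a * (if i ∈ S then 1 else 0) + b * (if i ∈ T then 1 else 0)) ^ 2 =
      a ^ 2 * S.card + b ^ 2 * T.card + 2 * a * b * (S ∩ T).card := by
  have h (i : Fin n) : (a * (if i ∈ S then 1 else 0) + b * (if i ∈ T then 1 else 0)) ^ 2 =
      a ^ 2 * (if i ∈ S then 1 else 0) + b ^ 2 * (if i ∈ T then 1 else 0) +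
        2 * a * b * (if i ∈ S ∩ T then 1 else 0) := by
    by_cases hS : i ∈ S <;> by_cases hT : i ∈ T <;> (simp [hS, hT]; try ring)
  simp_rw [h, Finset.sum_add_distrib, ← Finset.mul_sum]
  simp [-Finset.mem_inter]

theorem integrable_exp_setSum_add {n : ℕ} (S T : Finset (Fin n)) (a b : ℝ) :
    Integrable (fun x => Real.exp (a * setSum S x + b * setSum T x)) (nullMeasure n) := by
  simp_rw [combination_setSum_eq_linear]
  exact integrable_exp_linear _

theorem integral_exp_setSum_add {n : ℕ} (S T : Finset (Fin n)) (a b : ℝ) :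
    ∫ x, Real.exp (a * setSum S x + b * setSum T x) ∂(nullMeasure n) =
      Real.exp ((a ^ 2 * S.card + b ^ 2 * T.card + 2 * a * b * (S ∩ T).card) / 2) := by
  simp_rw [combination_setSum_eq_linear]
  rw [integral_exp_linear, ← Finset.sum_div, sum_combination_sq]

theorem integrable_exp_setSum {n : ℕ} (S : Finset (Fin n)) (a : ℝ) :
    Integrable (fun x => Real.exp (a * setSum S x)) (nullMeasure n) := by
  simpa using integrable_exp_setSum_add S S a 0

theorem integral_exp_setSum {n : ℕ} (S : Finset (Fin n)) (a : ℝ) :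
    ∫ x, Real.exp (a * setSum S x) ∂(nullMeasure n) = Real.exp (a ^ 2 * S.card / 2) := by
  simpa using integral_exp_setSum_add S S a 0

theorem canonicalDist_sq {n : ℕ} (S T : Finset (Fin n)) :
    canonicalDist S T ^ 2 = S.card + T.card - 2 * (S ∩ T).card := by
  have h (x : Fin n → ℝ) : setSum S x - setSum T x = 1 * setSum S x + (-1) * setSum T x := by ring
  rw [canonicalDist, Real.sq_sqrt (integral_nonneg fun x => sq_nonneg _)]
  simp_rw [h, combination_setSum_eq_linear]
  rw [integral_linear_sq, sum_combination_sq]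
  ring

/-! ### The soft maximum and its increments along a path -/

/-- The soft maximum `β⁻¹ log ∑_{S ∈ A} exp (β u_S)` of a finite family of reals. -/
def softMax {ι : Type*} (A : Finset ι) (β : ℝ) (u : ι → ℝ) : ℝ :=
  β⁻¹ * Real.log (∑ S ∈ A, Real.exp (β * u S))

/-- The Gibbs weight of a member of a finite family of reals. -/
def gibbsWeight {ι : Type*} (A : Finset ι) (β : ℝ) (u : ι → ℝ) (S : ι) : ℝ :=
  Real.exp (β * u S) / ∑ T ∈ A, Real.exp (β * u T)

section

variable {ι : Type*} {A : Finset ι}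

theorem sum_exp_pos (hA : A.Nonempty) (β : ℝ) (u : ι → ℝ) :
    0 < ∑ S ∈ A, Real.exp (β * u S) :=
  Finset.sum_pos (fun _ _ => Real.exp_pos _) hA

theorem gibbsWeight_nonneg (A : Finset ι) (β : ℝ) (u : ι → ℝ) (S : ι) :
    0 ≤ gibbsWeight A β u S :=
  div_nonneg (Real.exp_pos _).le (Finset.sum_nonneg fun _ _ => (Real.exp_pos _).le)

theorem sum_gibbsWeight (hA : A.Nonempty) (β : ℝ) (u : ι → ℝ) :
    ∑ S ∈ A, gibbsWeight A β u S = 1 := by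
  simp_rw [gibbsWeight]
  rw [← Finset.sum_div, div_self (sum_exp_pos hA β u).ne']

theorem sup'_le_softMax (hA : A.Nonempty) {β : ℝ} (hβ : 0 < β) (u : ι → ℝ) :
    A.sup' hA u ≤ softMax A β u := by
  refine Finset.sup'_le _ _ fun S hS => ?_
  rw [softMax, inv_mul_eq_div, le_div_iff₀ hβ, mul_comm, Real.le_log_iff_exp_le (sum_exp_pos hA β u)]
  exact Finset.single_le_sum (f := fun S => Real.exp (β * u S))
    (fun _ _ => (Real.exp_pos _).le) hS

/-- Each of the `|A|` exponentials is at most the largest. With `sup'_le_softMax`, the smoothing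
error vanishes uniformly as `β → ∞`. -/
theorem softMax_le_sup'_add (hA : A.Nonempty) {β : ℝ} (hβ : 0 < β) (u : ι → ℝ) :
    softMax A β u ≤ A.sup' hA u + Real.log A.card / β := by
  have hc : (0 : ℝ) < A.card := by exact_mod_cast hA.card_pos
  rw [softMax, inv_mul_eq_div, div_le_iff₀ hβ, add_mul, div_mul_cancel₀ _ hβ.ne',
    Real.log_le_iff_le_exp (sum_exp_pos hA β u), Real.exp_add, Real.exp_log hc, mul_comm,
    ← nsmul_eq_mul]
  refine Finset.sum_le_card_nsmul _ _ _ fun S hS => Real.exp_le_exp.2 ?_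
  rw [mul_comm]
  exact mul_le_mul_of_nonneg_right (Finset.le_sup' u hS) hβ.le

theorem hasDerivAt_softMax (hA : A.Nonempty) {β : ℝ} (hβ : 0 < β) {u v : ι → ℝ → ℝ} {t : ℝ}
    (h : ∀ S, HasDerivAt (u S) (v S t) t) :
    HasDerivAt (fun s => softMax A β fun S => u S s)
      (∑ S ∈ A, gibbsWeight A β (fun S => u S t) S * v S t) t := by
  have h1 : HasDerivAt (fun s => ∑ S ∈ A, Real.exp (β * u S s))
      (∑ S ∈ A, Real.exp (β * u S t) * (β * v S t)) t :=
    HasDerivAt.fun_sum fun S _ => ((h S).const_mul β).exp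
  have h2 := (h1.log (sum_exp_pos hA β fun S => u S t).ne').const_mul β⁻¹
  refine h2.congr_deriv ?_
  rw [Finset.sum_div, Finset.mul_sum]
  refine Finset.sum_congr rfl fun S _ => ?_
  rw [gibbsWeight]
  field_simp

theorem continuous_gibbsWeight (hA : A.Nonempty) (β : ℝ) {X : Type*} [TopologicalSpace X]
    {u : ι → X → ℝ} (hu : ∀ S, Continuous (u S)) (S : ι) :
    Continuous fun x => gibbsWeight A β (fun S => u S x) S := by
  unfold gibbsWeight
  exact Continuous.div (by fun_prop) (by fun_prop) fun x => (sum_exp_pos hA β _).ne'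

theorem continuous_softMax (hA : A.Nonempty) (β : ℝ) {X : Type*} [TopologicalSpace X]
    {u : ι → X → ℝ} (hu : ∀ S, Continuous (u S)) :
    Continuous fun x => softMax A β fun S => u S x := by
  unfold softMax
  exact continuous_const.mul
    (Continuous.log (by fun_prop) fun x => (sum_exp_pos hA β _).ne')

/-- Jensen's inequality for the increment of a soft maximum along a path. -/
theorem exp_softMax_sub_le (hA : A.Nonempty) {β : ℝ} (hβ : 0 < β) (l : ℝ) {a b : ℝ} (hab : a < b)
    {u v : ι → ℝ → ℝ} (h : ∀ S t, HasDerivAt (u S) (v S t) t) (hv : ∀ S, Continuous (v S)) :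
    Real.exp (l * (softMax A β (fun S => u S b) - softMax A β fun S => u S a)) ≤
      (b - a)⁻¹ * ∫ t in Set.Ioc a b,
        ∑ S ∈ A, gibbsWeight A β (fun S => u S t) S * Real.exp (l * (b - a) * v S t) := by
  have hu (S) : Continuous (u S) := continuous_iff_continuousAt.2 fun t => (h S t).continuousAt
  have hw := continuous_gibbsWeight hA β hu
  have hba : 0 < b - a := sub_pos.2 hab
  have hd : Continuous fun t => ∑ S ∈ A, gibbsWeight A β (fun S => u S t) S * v S t := by
    fun_prop
  have hftc := intervalIntegral.integral_eq_sub_of_hasDerivAt (a := a) (b := b)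
    (fun t _ => hasDerivAt_softMax hA hβ (fun S => h S t)) (hd.intervalIntegrable a b)
  have hvol : volume.real (Set.Ioc a b) = b - a := by simp [hab.le]
  have hint {g : ℝ → ℝ} (hg : Continuous g) : IntegrableOn g (Set.Ioc a b) :=
    (hg.intervalIntegrable a b).1
  -- First Jensen: the increment is a time average of `b - a` times the derivative.
  have hJ := convexOn_exp.map_set_average_le (μ := volume) (t := Set.Ioc a b)
    (f := fun t => l * (b - a) * ∑ S ∈ A, gibbsWeight A β (fun S => u S t) S * v S t)
    Real.continuous_exp.continuousOn isClosed_univ (by simp [hab]) (by simp) (by simp)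
    (hint (by fun_prop)) (hint (by fun_prop))
  rw [setAverage_eq, setAverage_eq, hvol, integral_const_mul,
    ← intervalIntegral.integral_of_le hab.le, hftc, smul_eq_mul, smul_eq_mul] at hJ
  have he : (b - a)⁻¹ * (l * (b - a) *
      (softMax A β (fun S => u S b) - softMax A β fun S => u S a)) =
      l * (softMax A β (fun S => u S b) - softMax A β fun S => u S a) := by
    field_simp
  rw [he] at hJ
  refine hJ.trans (mul_le_mul_of_nonneg_left ?_ (inv_nonneg.2 hba.le))
  refine setIntegral_mono (hint (by fun_prop)) (hint (by fun_prop)) fun t => ?_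
  -- Second Jensen: at each time the derivative is a convex combination with Gibbs weights.
  have := convexOn_exp.map_sum_le (t := A) (w := gibbsWeight A β fun S => u S t)
    (p := fun S => l * (b - a) * v S t) (fun S _ => gibbsWeight_nonneg A β _ S)
    (sum_gibbsWeight hA β _) (by simp)
  simp only [smul_eq_mul] at this
  refine le_trans (le_of_eq ?_) this
  rw [Finset.mul_sum]
  congr 1
  exact Finset.sum_congr rfl fun S _ => by ring

end

/-! ### Concentration of the maximum by rotation -/

section

variable {n : ℕ} {A : Finset (Finset (Fin n))}

theorem continuous_sup'_setSum (hA : A.Nonempty) :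
    Continuous fun x : Fin n → ℝ => A.sup' hA fun S => setSum S x :=
  Continuous.finset_sup'_apply hA fun S _ => continuous_setSum S

theorem integrable_exp_sup'_setSum (hA : A.Nonempty) (c : ℝ) :
    Integrable (fun x => Real.exp (c * A.sup' hA fun S => setSum S x)) (nullMeasure n) := by
  have hc := continuous_sup'_setSum hA
  refine (integrable_finsetSum A fun S _ => integrable_exp_setSum S c).mono'
    (Continuous.aestronglyMeasurable (by fun_prop)) (.of_forall fun x => ?_)
  obtain ⟨S, hS, h⟩ := Finset.exists_mem_eq_sup' hA fun S => setSum S x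
  rw [h, Real.norm_of_nonneg (Real.exp_pos _).le]
  exact Finset.single_le_sum (f := fun S => Real.exp (c * setSum S x))
    (fun _ _ => (Real.exp_pos _).le) hS

theorem integrable_of_integrable_exp {Ω : Type*} [MeasurableSpace Ω] {P : Measure Ω} {f : Ω → ℝ}
    (hf : AEStronglyMeasurable f P) (h : ∀ c : ℝ, Integrable (fun x => Real.exp (c * f x)) P) :
    Integrable f P := by
  refine ((h 1).add (h (-1))).mono' hf (.of_forall fun x => ?_)
  simp only [Pi.add_apply, one_mul, neg_one_mul, Real.norm_eq_abs]
  refine abs_le'.2 ⟨?_, ?_⟩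
  · linarith [Real.add_one_le_exp (f x), Real.exp_pos (-f x)]
  · linarith [Real.add_one_le_exp (-f x), Real.exp_pos (f x)]

theorem integrable_sup'_setSum (hA : A.Nonempty) :
    Integrable (fun x => A.sup' hA fun S => setSum S x) (nullMeasure n) :=
  integrable_of_integrable_exp (continuous_sup'_setSum hA).aestronglyMeasurable
    (integrable_exp_sup'_setSum hA)

theorem expectedMax_nonneg (hA : A.Nonempty) : 0 ≤ expectedMax A hA := by
  obtain ⟨S, hS⟩ := id hA
  rw [← integral_setSum S]
  exact integral_mono (integrable_setSum S) (integrable_sup'_setSum hA)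
    fun x => Finset.le_sup' (fun S => setSum S x) hS

theorem continuous_softMax_setSum (hA : A.Nonempty) (β : ℝ) :
    Continuous fun x : Fin n → ℝ => softMax A β fun S => setSum S x :=
  continuous_softMax hA β continuous_setSum

theorem integrable_exp_softMax_setSum (hA : A.Nonempty) {β : ℝ} (hβ : 0 < β) (c : ℝ) :
    Integrable (fun x => Real.exp (c * softMax A β fun S => setSum S x)) (nullMeasure n) := by
  have hc := continuous_softMax_setSum (n := n) hA β
  refine ((integrable_exp_sup'_setSum hA c).const_mul
    (Real.exp (|c| * (Real.log A.card / β)))).mono'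
    (Continuous.aestronglyMeasurable (by fun_prop)) (.of_forall fun x => ?_)
  rw [Real.norm_of_nonneg (Real.exp_pos _).le, ← Real.exp_add, Real.exp_le_exp]
  have h1 := sup'_le_softMax hA hβ fun S => setSum S x
  have h2 := softMax_le_sup'_add hA hβ fun S => setSum S x
  have h3 : c * ((softMax A β fun S => setSum S x) - A.sup' hA fun S => setSum S x) ≤
      |c| * (Real.log A.card / β) :=
    mul_le_mul (le_abs_self c) (by linarith) (by linarith) (abs_nonneg c)
  linarith

theorem integrable_softMax_setSum (hA : A.Nonempty) {β : ℝ} (hβ : 0 < β) :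
    Integrable (fun x => softMax A β fun S => setSum S x) (nullMeasure n) :=
  integrable_of_integrable_exp (continuous_softMax_setSum hA β).aestronglyMeasurable
    (integrable_exp_softMax_setSum hA hβ)

theorem integrable_gibbsWeight_setSum (hA : A.Nonempty) (β : ℝ) {S : Finset (Fin n)} (hS : S ∈ A) :
    Integrable (fun x => gibbsWeight A β (fun S => setSum S x) S) (nullMeasure n) := by
  refine (integrable_const (1 : ℝ)).mono'
    (continuous_gibbsWeight hA β continuous_setSum S).aestronglyMeasurable (.of_forall fun x => ?_)
  rw [Real.norm_of_nonneg (gibbsWeight_nonneg A β _ S), ← sum_gibbsWeight hA β fun S => setSum S x]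
  exact Finset.single_le_sum (f := gibbsWeight A β fun S => setSum S x)
    (fun S _ => gibbsWeight_nonneg A β _ S) hS

/-- The tilted Gibbs average appearing as the derivative term in the interpolation. -/
def gibbsExp (A : Finset (Finset (Fin n))) (β c : ℝ) (p : (Fin n → ℝ) × (Fin n → ℝ)) : ℝ :=
  ∑ S ∈ A, gibbsWeight A β (fun S => setSum S p.1) S * Real.exp (c * setSum S p.2)

theorem continuous_gibbsExp (hA : A.Nonempty) (β c : ℝ) : Continuous (gibbsExp A β c) := by
  have := continuous_gibbsWeight hA β fun S => continuous_setSum (n := n) S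
  unfold gibbsExp
  refine continuous_finsetSum _ fun S _ => ?_
  exact ((this S).comp continuous_fst).mul (by fun_prop)

theorem gibbsExp_nonneg (A : Finset (Finset (Fin n))) (β c : ℝ) (p) : 0 ≤ gibbsExp A β c p :=
  Finset.sum_nonneg fun S _ => mul_nonneg (gibbsWeight_nonneg A β _ S) (Real.exp_pos _).le

/-- Weights and exponentials depend on independent components. Equal cardinalities give all
exponentials the same mean, and the weights sum to one, so the size of `A` does not enter. -/
theorem lintegral_gibbsExp (hA : A.Nonempty) (β c : ℝ) {K : ℕ} (hK : ∀ S ∈ A, S.card = K) :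
    ∫⁻ p, ENNReal.ofReal (gibbsExp A β c p) ∂((nullMeasure n).prod (nullMeasure n)) =
      ENNReal.ofReal (Real.exp (c ^ 2 * K / 2)) := by
  have hi (S) (hS : S ∈ A) := (integrable_gibbsWeight_setSum hA β hS).mul_prod
    (integrable_exp_setSum S c)
  have hG : Integrable (gibbsExp A β c) ((nullMeasure n).prod (nullMeasure n)) :=
    integrable_finsetSum _ hi
  rw [← ofReal_integral_eq_lintegral_ofReal hG
    (.of_forall (gibbsExp_nonneg A β c))]
  congr 1
  simp only [gibbsExp]
  rw [integral_finsetSum _ hi]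
  have h (S) (hS : S ∈ A) :
      ∫ p : (Fin n → ℝ) × (Fin n → ℝ), gibbsWeight A β (fun S => setSum S p.1) S *
        Real.exp (c * setSum S p.2) ∂((nullMeasure n).prod (nullMeasure n)) =
      (∫ x, gibbsWeight A β (fun S => setSum S x) S ∂(nullMeasure n)) *
        Real.exp (c ^ 2 * K / 2) := by
    rw [integral_prod_mul (fun x => gibbsWeight A β (fun S => setSum S x) S)
      (fun y => Real.exp (c * setSum S y)), integral_exp_setSum, hK S hS]
  rw [Finset.sum_congr rfl h, ← Finset.sum_mul,
    ← integral_finsetSum _ fun S hS => integrable_gibbsWeight_setSum hA β hS]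
  simp [sum_gibbsWeight hA]

theorem continuous_rotation_uncurry :
    Continuous fun q : ((Fin n → ℝ) × (Fin n → ℝ)) × ℝ =>
      ContinuousLinearMap.rotation q.2 q.1 := by
  simp only [ContinuousLinearMap.rotation_apply]
  fun_prop

/-- The first component of the rotated pair runs from `p.1` to `p.2`, and its time derivative is the
second component. -/
theorem exp_softMax_setSum_sub_le (hA : A.Nonempty) {β : ℝ} (hβ : 0 < β) (l : ℝ)
    (p : (Fin n → ℝ) × (Fin n → ℝ)) :
    Real.exp (l * ((softMax A β fun S => setSum S p.2) - softMax A β fun S => setSum S p.1)) ≤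
      (Real.pi / 2)⁻¹ * ∫ t in Set.Ioc 0 (Real.pi / 2),
        gibbsExp A β (l * (Real.pi / 2)) (ContinuousLinearMap.rotation t p) := by
  have h := exp_softMax_sub_le hA hβ l (a := 0) (b := Real.pi / 2) (by positivity)
    (u := fun S t => setSum S (ContinuousLinearMap.rotation t p).1)
    (v := fun S t => setSum S (ContinuousLinearMap.rotation t p).2)
    (fun S t => by
      simp only [ContinuousLinearMap.rotation_apply, setSum_smul_add]
      exact ((Real.hasDerivAt_cos t).mul_const _).add ((Real.hasDerivAt_sin t).mul_const _))
    (fun S => by simp only [ContinuousLinearMap.rotation_apply]; fun_prop)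
  simpa [ContinuousLinearMap.rotation_apply, gibbsExp] using h

/-- Averaging a function over all rotations by an acute angle preserves its Gaussian integral. -/
theorem lintegral_rotation_average {G : (Fin n → ℝ) × (Fin n → ℝ) → ℝ} (hG : Continuous G)
    (hG0 : ∀ p, 0 ≤ G p) :
    ∫⁻ p, ENNReal.ofReal ((Real.pi / 2)⁻¹ * ∫ t in Set.Ioc 0 (Real.pi / 2),
        G (ContinuousLinearMap.rotation t p)) ∂((nullMeasure n).prod (nullMeasure n)) =
      ∫⁻ p, ENNReal.ofReal (G p) ∂((nullMeasure n).prod (nullMeasure n)) := by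
  have hπ : 0 < Real.pi / 2 := by positivity
  have hm : Measurable fun q : ((Fin n → ℝ) × (Fin n → ℝ)) × ℝ =>
      ENNReal.ofReal (G (ContinuousLinearMap.rotation q.2 q.1)) :=
    (hG.comp continuous_rotation_uncurry).measurable.ennreal_ofReal
  have h1 (p : (Fin n → ℝ) × (Fin n → ℝ)) :
      ENNReal.ofReal ((Real.pi / 2)⁻¹ * ∫ t in Set.Ioc 0 (Real.pi / 2),
        G (ContinuousLinearMap.rotation t p)) =
      ENNReal.ofReal (Real.pi / 2)⁻¹ * ∫⁻ t in Set.Ioc 0 (Real.pi / 2),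
        ENNReal.ofReal (G (ContinuousLinearMap.rotation t p)) := by
    have hr : Continuous fun t : ℝ => ContinuousLinearMap.rotation t p := by
      simp only [ContinuousLinearMap.rotation_apply]
      fun_prop
    have hc : Continuous fun t : ℝ => G (ContinuousLinearMap.rotation t p) := hG.comp hr
    have hi : Integrable (fun t : ℝ => G (ContinuousLinearMap.rotation t p))
        (volume.restrict (Set.Ioc 0 (Real.pi / 2))) :=
      (hc.intervalIntegrable 0 (Real.pi / 2)).1
    rw [ENNReal.ofReal_mul (by positivity),
      ofReal_integral_eq_lintegral_ofReal hi (.of_forall fun t => hG0 _)]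
  have h2 (t : ℝ) : ∫⁻ p, ENNReal.ofReal (G (ContinuousLinearMap.rotation t p))
      ∂((nullMeasure n).prod (nullMeasure n)) =
      ∫⁻ p, ENNReal.ofReal (G p) ∂((nullMeasure n).prod (nullMeasure n)) := by
    conv_rhs => rw [← map_rotation_nullMeasure n t]
    rw [lintegral_map hG.measurable.ennreal_ofReal (by fun_prop)]
  simp_rw [h1]
  rw [lintegral_const_mul' _ _ ENNReal.ofReal_ne_top, lintegral_lintegral_swap hm.aemeasurable]
  simp_rw [h2]
  rw [setLIntegral_const, Real.volume_Ioc, sub_zero, mul_left_comm,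
    ← ENNReal.ofReal_mul (by positivity), inv_mul_cancel₀ hπ.ne', ENNReal.ofReal_one, mul_one]

theorem lintegral_exp_softMax_sub_le (hA : A.Nonempty) {β : ℝ} (hβ : 0 < β) (l : ℝ) {K : ℕ}
    (hK : ∀ S ∈ A, S.card = K) :
    ∫⁻ p, ENNReal.ofReal (Real.exp (l * ((softMax A β fun S => setSum S p.2) -
        softMax A β fun S => setSum S p.1))) ∂((nullMeasure n).prod (nullMeasure n)) ≤
      ENNReal.ofReal (Real.exp ((l * (Real.pi / 2)) ^ 2 * K / 2)) := by
  rw [← lintegral_gibbsExp (n := n) hA β _ hK,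
    ← lintegral_rotation_average (continuous_gibbsExp hA β _) (gibbsExp_nonneg A β _)]
  exact lintegral_mono fun p =>
    ENNReal.ofReal_le_ofReal (exp_softMax_setSum_sub_le hA hβ l p)

theorem integral_exp_softMax_sub_mean_le (hA : A.Nonempty) {β : ℝ} (hβ : 0 < β) (l : ℝ) {K : ℕ}
    (hK : ∀ S ∈ A, S.card = K) :
    ∫ x, Real.exp (l * ((softMax A β fun S => setSum S x) -
        ∫ y, softMax A β (fun S => setSum S y) ∂(nullMeasure n))) ∂(nullMeasure n) ≤
      Real.exp ((l * (Real.pi / 2)) ^ 2 * K / 2) := by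
  set f : (Fin n → ℝ) → ℝ := fun x => softMax A β fun S => setSum S x
  have hf : Integrable f (nullMeasure n) := integrable_softMax_setSum hA hβ
  have he (c : ℝ) : Integrable (fun x => Real.exp (c * f x)) (nullMeasure n) :=
    integrable_exp_softMax_setSum hA hβ c
  -- Jensen in the independent copy replaces that copy by its mean.
  have hJ : Real.exp (-l * ∫ y, f y ∂(nullMeasure n)) ≤
      ∫ y, Real.exp (-l * f y) ∂(nullMeasure n) := by
    rw [← integral_const_mul]
    exact convexOn_exp.map_integral_le Real.continuous_exp.continuousOn isClosed_univ (by simp)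
      (hf.const_mul _) (he (-l))
  have hsub (a b : ℝ) : Real.exp (l * (a - b)) = Real.exp (-l * b) * Real.exp (l * a) := by
    rw [← Real.exp_add]; congr 1; ring
  have hlin := lintegral_exp_softMax_sub_le hA hβ l hK
  simp_rw [hsub] at hlin ⊢
  rw [← ofReal_integral_eq_lintegral_ofReal ((he (-l)).mul_prod (he l))
    (.of_forall fun p => by positivity), ENNReal.ofReal_le_ofReal_iff (Real.exp_pos _).le,
    integral_prod_mul (fun x => Real.exp (-l * f x)) (fun y => Real.exp (l * f y))] at hlin
  rw [integral_const_mul]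
  exact (mul_le_mul_of_nonneg_right hJ (integral_nonneg fun _ => (Real.exp_pos _).le)).trans hlin

/-- Sub-Gaussian concentration of the maximum of a family of sums, with the Maurey–Pisier
constant. -/
theorem integral_exp_sup'_sub_expectedMax_le (hA : A.Nonempty) {l : ℝ} (hl : 0 ≤ l) {K : ℕ}
    (hK : ∀ S ∈ A, S.card = K) :
    ∫ x, Real.exp (l * ((A.sup' hA fun S => setSum S x) - expectedMax A hA)) ∂(nullMeasure n) ≤
      Real.exp ((l * (Real.pi / 2)) ^ 2 * K / 2) := by
  have hlim : Filter.Tendsto (fun β : ℝ => Real.exp (l * (Real.log A.card / β)) *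
      Real.exp ((l * (Real.pi / 2)) ^ 2 * K / 2)) Filter.atTop
      (nhds (Real.exp ((l * (Real.pi / 2)) ^ 2 * K / 2))) := by
    have h : Filter.Tendsto (fun β : ℝ => Real.log A.card / β) Filter.atTop (nhds 0) :=
      Filter.tendsto_id.const_div_atTop _
    simpa using ((Real.continuous_exp.tendsto _).comp (h.const_mul l)).mul_const
      (Real.exp ((l * (Real.pi / 2)) ^ 2 * K / 2))
  -- For fixed `β`, passing to the true maximum and its mean costs a factor `exp (l log |A| / β)`,
  -- which tends to `1`.
  refine ge_of_tendsto hlim ((Filter.eventually_gt_atTop 0).mono fun β hβ => ?_)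
  refine le_trans ?_ (mul_le_mul_of_nonneg_left (integral_exp_softMax_sub_mean_le hA hβ l hK)
    (Real.exp_pos _).le)
  have hmean : ∫ y, softMax A β (fun S => setSum S y) ∂(nullMeasure n) ≤
      expectedMax A hA + Real.log A.card / β := by
    refine (integral_mono (integrable_softMax_setSum hA hβ)
      ((integrable_sup'_setSum hA).add (integrable_const _))
      fun x => softMax_le_sup'_add hA hβ fun S => setSum S x).trans (le_of_eq ?_)
    simp only [Pi.add_apply]
    rw [integral_add (integrable_sup'_setSum hA) (integrable_const _)]
    simp [expectedMax]
  have hexp (g : (Fin n → ℝ) → ℝ) (m : ℝ)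
      (hg : Integrable (fun x => Real.exp (l * g x)) (nullMeasure n)) :
      Integrable (fun x => Real.exp (l * (g x - m))) (nullMeasure n) := by
    simp_rw [mul_sub, Real.exp_sub]
    exact hg.div_const _
  rw [← integral_const_mul]
  refine integral_mono (hexp _ _ (integrable_exp_sup'_setSum hA l))
    ((hexp _ _ (integrable_exp_softMax_setSum hA hβ l)).const_mul _) fun x => ?_
  simp only
  rw [← Real.exp_add, ← mul_add]
  refine Real.exp_le_exp.2 (mul_le_mul_of_nonneg_left ?_ hl)
  linarith [sup'_le_softMax hA hβ fun S => setSum S x]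

end

/-! ### Likelihood ratio and type I error -/

section

variable {n : ℕ}

theorem altDensity_div_nullDensity (μ : ℝ) (S : Finset (Fin n)) (x : Fin n → ℝ) :
    altDensity μ S x / nullDensity n x = Real.exp (μ * setSum S x - S.card * μ ^ 2 / 2) := by
  have hpos : (0 : ℝ) < (2 * Real.pi) ^ (-(n : ℝ) / 2) := by positivity
  rw [altDensity, nullDensity, mul_div_mul_left _ _ hpos.ne', ← Real.exp_sub]
  congr 1
  rw [← Finset.sum_add_sum_compl S fun i => x i ^ 2 / 2]
  have h : ∑ i ∈ S, (x i - μ) ^ 2 / 2 =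
      ∑ i ∈ S, x i ^ 2 / 2 - (μ * setSum S x - S.card * μ ^ 2 / 2) := by
    rw [setSum, Finset.mul_sum, mul_div_assoc, ← nsmul_eq_mul, ← Finset.sum_const,
      ← Finset.sum_sub_distrib, ← Finset.sum_sub_distrib]
    exact Finset.sum_congr rfl fun i _ => by ring
  rw [h]
  ring

theorem likelihoodRatio_eq (C : Finset (Finset (Fin n))) (μ : ℝ) (x : Fin n → ℝ) :
    likelihoodRatio C μ x =
      1 / C.card * ∑ S ∈ C, Real.exp (μ * setSum S x - S.card * μ ^ 2 / 2) := by
  rw [likelihoodRatio, mul_div_assoc, Finset.sum_div]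
  simp_rw [altDensity_div_nullDensity]

theorem optimalTest_eq_one_iff (C : Finset (Finset (Fin n))) (μ : ℝ) (x : Fin n → ℝ) :
    optimalTest C μ x = 1 ↔ 1 < likelihoodRatio C μ x := by
  simp [optimalTest]

/-- The squared distance is `2 (K - |S ∩ T|)`, and the cover makes it at most `K / 4`. -/
theorem IsCover.exists_card_inter {K : ℕ} {C A : Finset (Finset (Fin n))}
    (hcard : ∀ S ∈ C, S.card = K) (hA : IsCover (Real.sqrt (K : ℝ) / 2) C A) :
    ∀ S ∈ C, ∃ T ∈ A, 7 / 8 * (K : ℝ) ≤ (S ∩ T).card := by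
  intro S hS
  obtain ⟨T, hT, hd⟩ := hA.2 S hS
  refine ⟨T, hT, ?_⟩
  have h := pow_le_pow_left₀ (Real.sqrt_nonneg _) hd 2
  rw [← canonicalDist, canonicalDist_sq, div_pow, Real.sq_sqrt (Nat.cast_nonneg K), hcard S hS,
    hcard T (hA.1 hT)] at h
  linarith

/-- The mean of the tilted exponential that bounds the likelihood ratio on the event that the
maximum over the cover is at most `a`. -/
theorem integral_exp_tilt (S T : Finset (Fin n)) {K : ℕ} (hS : S.card = K) (hT : T.card = K)
    (μ l a : ℝ) :
    ∫ x, Real.exp (μ * setSum S x - S.card * μ ^ 2 / 2) * Real.exp (l * (a - setSum T x))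
        ∂(nullMeasure n) =
      Real.exp (l * a + K * l ^ 2 / 2 - μ * l * (S ∩ T).card) := by
  have h (x : Fin n → ℝ) :
      Real.exp (μ * setSum S x - S.card * μ ^ 2 / 2) * Real.exp (l * (a - setSum T x)) =
        Real.exp (l * a - K * μ ^ 2 / 2) * Real.exp (μ * setSum S x + -l * setSum T x) := by
    rw [← Real.exp_add, ← Real.exp_add, hS]; congr 1; ring
  simp_rw [h]
  rw [integral_const_mul, integral_exp_setSum_add, ← Real.exp_add, hS, hT]
  congr 1
  ring

theorem integrable_exp_tilt (S T : Finset (Fin n)) (μ l a : ℝ) :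
    Integrable (fun x => Real.exp (μ * setSum S x - S.card * μ ^ 2 / 2) *
      Real.exp (l * (a - setSum T x))) (nullMeasure n) := by
  have h (x : Fin n → ℝ) :
      Real.exp (μ * setSum S x - S.card * μ ^ 2 / 2) * Real.exp (l * (a - setSum T x)) =
        Real.exp (l * a - S.card * μ ^ 2 / 2) * Real.exp (μ * setSum S x + -l * setSum T x) := by
    rw [← Real.exp_add, ← Real.exp_add]; congr 1; ring
  simp_rw [h]
  exact (integrable_exp_setSum_add S T μ (-l)).const_mul _

/-- Either the maximum over the cover is large, or the likelihood ratio is dominated by a tilted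
average. -/
theorem typeIError_le {K : ℕ} {C A : Finset (Finset (Fin n))} (hC : C.Nonempty)
    (hcard : ∀ S ∈ C, S.card = K) (hAC : A ⊆ C) (hA : A.Nonempty) {q μ l r : ℝ}
    (hq : ∀ S ∈ C, ∃ T ∈ A, q ≤ (S ∩ T).card) (hμ : 0 ≤ μ) (hl : 0 ≤ l) :
    (nullMeasure n).real {x | optimalTest C μ x = 1} ≤
      Real.exp (-(l * r) + (l * (Real.pi / 2)) ^ 2 * K / 2) +
        Real.exp (l * (expectedMax A hA + r) + K * l ^ 2 / 2 - μ * l * q) := by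
  choose! τ hτA hτq using hq
  set E := expectedMax A hA with hE
  set F : (Fin n → ℝ) → ℝ := fun x =>
    Real.exp (-(l * r)) * Real.exp (l * ((A.sup' hA fun S => setSum S x) - E)) with hF
  set H : (Fin n → ℝ) → ℝ := fun x => 1 / (C.card : ℝ) * ∑ S ∈ C,
    Real.exp (μ * setSum S x - S.card * μ ^ 2 / 2) *
      Real.exp (l * (E + r - setSum (τ S) x)) with hH
  have hN : (0 : ℝ) < C.card := by exact_mod_cast hC.card_pos
  have hFi : Integrable F (nullMeasure n) := by
    refine Integrable.const_mul ?_ _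
    simp_rw [mul_sub, Real.exp_sub]
    exact (integrable_exp_sup'_setSum hA l).div_const _
  have hHi : Integrable H (nullMeasure n) :=
    (integrable_finsetSum _ fun S _ => integrable_exp_tilt S (τ S) μ l (E + r)).const_mul _
  have hF0 (x) : 0 ≤ F x := by positivity
  have hH0 (x) : 0 ≤ H x := by positivity
  have hsub : {x | optimalTest C μ x = 1} ⊆ {x | 1 ≤ (F + H) x} := by
    intro x hx
    have hL : 1 < likelihoodRatio C μ x := (optimalTest_eq_one_iff C μ x).1 hx
    change 1 ≤ F x + H x
    rcases le_or_gt (E + r) (A.sup' hA fun S => setSum S x) with hM | hM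
    · have : 1 ≤ F x := by
        rw [hF]
        simp only
        rw [← Real.exp_add, Real.one_le_exp_iff]
        nlinarith
      linarith [hH0 x]
    · have : likelihoodRatio C μ x ≤ H x := by
        rw [likelihoodRatio_eq]
        refine mul_le_mul_of_nonneg_left (Finset.sum_le_sum fun S hS => ?_) (by positivity)
        refine le_mul_of_one_le_right (Real.exp_pos _).le (Real.one_le_exp_iff.2 ?_)
        have := Finset.le_sup' (fun S => setSum S x) (hτA S hS)
        exact mul_nonneg hl (by linarith)
      linarith [hF0 x]
  have hFint : ∫ x, F x ∂(nullMeasure n) ≤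
      Real.exp (-(l * r) + (l * (Real.pi / 2)) ^ 2 * K / 2) := by
    rw [integral_const_mul, Real.exp_add]
    exact mul_le_mul_of_nonneg_left
      (integral_exp_sup'_sub_expectedMax_le hA hl fun S hS => hcard S (hAC hS)) (Real.exp_pos _).le
  have hHint : ∫ x, H x ∂(nullMeasure n) ≤ Real.exp (l * (E + r) + K * l ^ 2 / 2 - μ * l * q) := by
    rw [integral_const_mul, integral_finsetSum _ fun S _ => integrable_exp_tilt S (τ S) μ l (E + r),
      one_div, inv_mul_le_iff₀ hN, ← nsmul_eq_mul]
    refine Finset.sum_le_card_nsmul _ _ _ fun S hS => ?_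
    rw [integral_exp_tilt S (τ S) (hcard S hS) (hcard _ (hAC (hτA S hS)))]
    exact Real.exp_le_exp.2
      (by linarith [mul_le_mul_of_nonneg_left (hτq S hS) (mul_nonneg hμ hl)])
  -- Markov at level `1`: `F` handles a large maximum, `H` dominates the likelihood ratio otherwise.
  have hMarkov := mul_meas_ge_le_integral_of_nonneg (μ := nullMeasure n)
    (.of_forall fun x => add_nonneg (hF0 x) (hH0 x)) (hFi.add hHi) 1
  rw [one_mul] at hMarkov
  refine (measureReal_mono hsub).trans (hMarkov.trans ?_)
  rw [integral_add hFi hHi]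
  exact add_le_add hFint hHint

end

end

end GaussianTesting


/-! ### Choice of parameters -/

theorem mainTheorem5 (n K : ℕ) (hK : 0 < K) (C : Finset (Finset (Fin n)))
    (hC : C.Nonempty) (hcard : ∀ S ∈ C, S.card = K)
    (A : Finset (Finset (Fin n)))
    (hA : GaussianTesting.IsCover (Real.sqrt (K : ℝ) / 2) C A)
    (δ : ℝ) (hδ0 : 0 < δ) (hδ1 : δ < 1) (μ : ℝ) (hμ : 0 < μ)
    (hbound : 2 / (K : ℝ) * GaussianTesting.expectedMax A (hA.nonempty hC)
      + Real.sqrt (32 * Real.log (2 / δ) / (K : ℝ)) ≤ μ) :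
    (GaussianTesting.nullMeasure n).real
      {x | GaussianTesting.optimalTest C μ x = 1} ≤ δ := by
  have hK' : (0 : ℝ) < K := by exact_mod_cast hK
  set ℓ := Real.log (2 / δ) with hℓ
  have hℓ0 : 0 ≤ ℓ := Real.log_nonneg (by rw [le_div_iff₀ hδ0]; linarith)
  have hE := GaussianTesting.expectedMax_nonneg (hA.nonempty hC)
  set E := GaussianTesting.expectedMax A (hA.nonempty hC) with hEdef
  -- The tilt `l = s` makes `K l² = ℓ`, so both exponents are compared with multiples of `ℓ`.
  set s := Real.sqrt (ℓ / K) with hs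
  have hs0 : 0 ≤ s := Real.sqrt_nonneg _
  have hs2 : K * s ^ 2 = ℓ := by rw [hs, Real.sq_sqrt (by positivity)]; field_simp
  -- A rational stand-in for `√32`: `(28/5)² = 31.36`.
  have h32 : 28 / 5 * s ≤ Real.sqrt (32 * ℓ / K) := by
    refine Real.le_sqrt_of_sq_le ?_
    rw [mul_div_assoc, mul_pow, hs, Real.sq_sqrt (by positivity)]
    have : 0 ≤ ℓ / K := by positivity
    linarith
  have hKμ : 2 * E + 28 / 5 * (K * s) ≤ K * μ := by
    have h := mul_le_mul_of_nonneg_left ((add_le_add_right h32 _).trans hbound) hK'.le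
    have h' : (K : ℝ) * (2 / K * E + 28 / 5 * s) = 2 * E + 28 / 5 * (K * s) := by field_simp
    rwa [h'] at h
  have hδ : Real.exp (-ℓ) = δ / 2 := by
    rw [Real.exp_neg, hℓ, Real.exp_log (by positivity), inv_div]
  -- With `r = 3Ks` the first exponent is `(π²/8 - 3) ℓ`, below `-ℓ`.
  refine (GaussianTesting.typeIError_le (r := 3 * (K * s)) hC hcard hA.1 (hA.nonempty hC)
    (hA.exists_card_inter hcard) hμ.le hs0).trans ?_
  have hπ : Real.pi ^ 2 ≤ 10 := by nlinarith [Real.pi_lt_d2, Real.pi_pos]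
  have h1 : -(s * (3 * (K * s))) + (s * (Real.pi / 2)) ^ 2 * K / 2 ≤ -ℓ := by
    have : -(s * (3 * (K * s))) + (s * (Real.pi / 2)) ^ 2 * K / 2 =
        ℓ * (-3 + Real.pi ^ 2 / 8) := by rw [← hs2]; ring
    rw [this]
    nlinarith
  have h2 : s * (E + 3 * (K * s)) + K * s ^ 2 / 2 - μ * s * (7 / 8 * K) ≤ -ℓ := by
    -- Here `7/8 · 28/5 = 4.9 ≥ 4.5` and `7/8 · 2 ≥ 1`; the latter needs `E ≥ 0`.
    have h3 : E + 3 * (K * s) + 3 / 2 * (K * s) ≤ 7 / 8 * (K * μ) := by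
      have : 0 ≤ K * s := by positivity
      linarith
    have := mul_le_mul_of_nonneg_left h3 hs0
    rw [← hs2]
    linarith
  linarith [Real.exp_le_exp.2 h1, Real.exp_le_exp.2 h2]
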